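/- Conventions. A subshift is a closed subset $X\subseteq A^{\mathbb Z}$, for a finite discrete alphabet $A$, that is invariant under the two-sided shift $\sigma$. Its blocks are the finite words occurring in points of $X$. $X$ is irreducible if for all blocks $u,v$ of $X$ there is a word $w$ such that $uwv$ is a block of $X$, and sofic if it is the set of label sequences of bi-infinite paths in some finite labelled directed graph. A factor code $\pi:X\to Y$ between subshifts is a continuous shift-commuting surjection; it is finite-to-one if every fibre $\pi^{-1}(y)$ is finite. A measure means a Borel probability measure, ergodic measures are shift-invariant, and $\nu$ is fully supported if every nonempty open set has positive $\nu$-measure. A point of $Y$ is doubly transitive if every block of $Y$ occurs in it infinitely often to the left and infinitely often to the right. Theorem. Let $X$ be an irreducible sofic shift, $\pi:X\to Y$ a finite-to-one factor code onto a subshift $Y$, and $\nu$ a fully supported ergodic measure on $Y$. (i) $Y$ has doubly transitive points, and there is a number $d_\pi\in\mathbb N$, the degree of $\pi$, such that every doubly transitive point of $Y$ has exactly $d_\pi$ preimages under $\pi$. Call a measure $\lambda$ on $X^{d_\pi}$ a degree joining over $\nu$ if it is invariant and ergodic under the coordinatewise shift, $\lambda$-almost every $(x_1,\dots,x_{d_\pi})$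 consists of $d_\pi$ distinct points with $\pi(x_1)=\dots=\pi(x_{d_\pi})$, and the image of $\lambda$ under $(x_1,\dots,x_{d_\pi})\mapsto \pi(x_i)$ is $\nu$ for some (equivalently, every) $i$. Let $p_i\lambda$ denote the $i$-th margin of $\lambda$. An ergodic lift of $\nu$ is an ergodic measure $\mu$ on $X$ whose pushforward $\pi\mu$ equals $\nu$. (ii) There is a degree joining over $\nu$, and for every ergodic lift $\mu$ of $\nu$ the number $$m_\pi(\mu)=\#\{i: 1\le i\le d_\pi,\ p_i\lambda=\mu\}$$ is the same for all degree joinings $\lambda$ over $\nu$; it is called the multiplicity of $\mu$. (iii) $\nu$ has only finitely many ergodic lifts, and $$d_\pi=\sum_{\mu} m_\pi(\mu),$$ where $\mu$ runs over all ergodic lifts of $\nu$. -/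

import Mathlib

open MeasureTheory SymbolicDynamics.FullShift

noncomputable section

namespace FactorCode

/-- The shift map of a two-sided subshift `X`: `(σ x) k = x (1 + k)`. -/
def shiftMap {A : Type*} [TopologicalSpace A] (X : Subshift A ℤ) (x : X.carrier) : X.carrier :=
  (X.mapsTo 1).restrict (shift (1 : ℤ)) X.carrier X.carrier x

/-- The block (finite word) `w` occurs in the bi-infinite sequence `x` at position `i`. -/
def OccursAt {A : Type*} (w : List A) (x : ℤ → A) (i : ℤ) : Prop :=
  ∀ k : Fin w.length, x (i + (k : ℕ)) = w.get k

/-- The language of `X`: all blocks which occur in points of `X`. -/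
def language {A : Type*} [TopologicalSpace A] (X : Subshift A ℤ) : Set (List A) :=
  {w | ∃ x ∈ X.carrier, ∃ i : ℤ, OccursAt w x i}

/-- `X` is irreducible: for any two blocks `u`, `v` of `X` there is a block `w` such that `u w v`
is a block of `X`. -/
def IsIrreducible {A : Type*} [TopologicalSpace A] (X : Subshift A ℤ) : Prop :=
  ∀ u ∈ language X, ∀ v ∈ language X, ∃ w : List A, u ++ w ++ v ∈ language X

/-- `X` is sofic: it is presented by a finite labelled directed graph, i.e. `X` is the set of label
sequences of bi-infinite paths. The vertices are `Fin n`, and `E s a t` says that there is an edge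
from `s` to `t` with label `a`. -/
def IsSofic {A : Type*} [TopologicalSpace A] (X : Subshift A ℤ) : Prop :=
  ∃ (n : ℕ) (E : Fin n → A → Fin n → Prop),
    X.carrier = {x | ∃ v : ℤ → Fin n, ∀ i : ℤ, E (v i) (x i) (v (i + 1))}

/-- A point of `X` is doubly transitive if each block of `X` occurs in it infinitely often to the
right and infinitely often to the left. -/
def IsDoublyTransitive {A : Type*} [TopologicalSpace A] {X : Subshift A ℤ}
    (x : X.carrier) : Prop :=
  ∀ w ∈ language X, ∀ N : ℤ,
    (∃ i : ℤ, N ≤ i ∧ OccursAt w x.1 i) ∧ (∃ i : ℤ, i ≤ N ∧ OccursAt w x.1 i)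

/-- A factor code `π : X → Y`: a continuous shift-commuting surjection between subshifts. -/
structure IsFactorCode {A B : Type*} [TopologicalSpace A] [TopologicalSpace B]
    {X : Subshift A ℤ} {Y : Subshift B ℤ} (π : X.carrier → Y.carrier) : Prop where
  continuous : Continuous π
  semiconj : Function.Semiconj π (shiftMap X) (shiftMap Y)
  surjective : Function.Surjective π

/-- Every fibre of `π` is finite. -/
def IsFiniteToOne {A B : Type*} [TopologicalSpace A] [TopologicalSpace B]
    {X : Subshift A ℤ} {Y : Subshift B ℤ} (π : X.carrier → Y.carrier) : Prop :=
  ∀ y : Y.carrier, (π ⁻¹' {y}).Finite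

/-- There are doubly transitive points in `Y`, and each of them has exactly `d` preimages. -/
def IsDegree {A B : Type*} [TopologicalSpace A] [TopologicalSpace B]
    {X : Subshift A ℤ} {Y : Subshift B ℤ} (π : X.carrier → Y.carrier) (d : ℕ) : Prop :=
  (∃ y : Y.carrier, IsDoublyTransitive y) ∧
    ∀ y : Y.carrier, IsDoublyTransitive y → (π ⁻¹' {y}).encard = (d : ℕ∞)

open Classical in
/-- The degree of `π`, i.e. the only `d` with `IsDegree π d` (and `0` if there is none). -/
def degree {A B : Type*} [TopologicalSpace A] [TopologicalSpace B]
    {X : Subshift A ℤ} {Y : Subshift B ℤ} (π : X.carrier → Y.carrier) : ℕ :=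
  if h : ∃ d : ℕ, IsDegree π d then h.choose else 0

/-- The diagonal (coordinatewise) shift on the `n`-fold product `X ^ n`. -/
def powShift {A : Type*} [TopologicalSpace A] (X : Subshift A ℤ) (n : ℕ)
    (x : Fin n → X.carrier) : Fin n → X.carrier :=
  fun i => shiftMap X (x i)

/-- The `i`-th margin of a measure on `X ^ n`. -/
def margin {A : Type*} [TopologicalSpace A] [MeasurableSpace A] {X : Subshift A ℤ} {n : ℕ}
    (ρ : Measure (Fin n → X.carrier)) (i : Fin n) : Measure X.carrier :=
  ρ.map (fun x => x i)

/-- `ρ` is an `n`-fold `π`-relative joining over `ν`: an invariant probability measure on `X ^ n`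
which gives full measure to the tuples with a common image under `π`, and whose image is `ν`. -/
structure IsRelativeJoining {A B : Type*} [TopologicalSpace A] [TopologicalSpace B]
    [MeasurableSpace A] [MeasurableSpace B] {X : Subshift A ℤ} {Y : Subshift B ℤ}
    (π : X.carrier → Y.carrier) (ν : Measure Y.carrier) (n : ℕ)
    (ρ : Measure (Fin n → X.carrier)) : Prop where
  isProbabilityMeasure : IsProbabilityMeasure ρ
  invariant : MeasurePreserving (powShift X n) ρ ρ
  ae_image_eq : ∀ᵐ x ∂ρ, ∀ i j : Fin n, π (x i) = π (x j)
  image_eq : ∃ i : Fin n, (margin ρ i).map π = ν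

/-- Almost every tuple consists of distinct points. -/
def IsSeparating {A : Type*} [TopologicalSpace A] [MeasurableSpace A] {X : Subshift A ℤ} {n : ℕ}
    (ρ : Measure (Fin n → X.carrier)) : Prop :=
  ∀ᵐ x ∂ρ, Function.Injective x

/-- A degree joining over `ν`: an ergodic separating `d`-fold relative joining over `ν`, where `d`
is the degree of `π`. -/
structure IsDegreeJoining {A B : Type*} [TopologicalSpace A] [TopologicalSpace B]
    [MeasurableSpace A] [MeasurableSpace B] {X : Subshift A ℤ} {Y : Subshift B ℤ}
    (π : X.carrier → Y.carrier) (ν : Measure Y.carrier)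
    (ρ : Measure (Fin (degree π) → X.carrier)) : Prop where
  isRelativeJoining : IsRelativeJoining π ν (degree π) ρ
  isSeparating : IsSeparating ρ
  ergodic : Ergodic (powShift X (degree π)) ρ

/-- The number of times `μ` occurs as a margin of `ρ`. -/
def marginCount {A : Type*} [TopologicalSpace A] [MeasurableSpace A] {X : Subshift A ℤ} {n : ℕ}
    (ρ : Measure (Fin n → X.carrier)) (μ : Measure X.carrier) : ℕ :=
  {i : Fin n | margin ρ i = μ}.ncard

open Classical in
/-- The multiplicity of `μ` with respect to `π`: the number of times `μ` occurs as a margin of a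
degree joining over the image `π μ` (and `0` if there is no degree joining over `π μ`). -/
def multiplicity {A B : Type*} [TopologicalSpace A] [TopologicalSpace B]
    [MeasurableSpace A] [MeasurableSpace B] {X : Subshift A ℤ} {Y : Subshift B ℤ}
    (π : X.carrier → Y.carrier) (μ : Measure X.carrier) : ℕ :=
  if h : ∃ ρ : Measure (Fin (degree π) → X.carrier), IsDegreeJoining π (μ.map π) ρ then
    marginCount h.choose μ
  else 0

/-- The ergodic lifts of `ν`: the ergodic shift-invariant probability measures on `X` with
image `ν`. -/
def ergodicLifts {A B : Type*} [TopologicalSpace A] [TopologicalSpace B]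
    [MeasurableSpace A] [MeasurableSpace B] {X : Subshift A ℤ} {Y : Subshift B ℤ}
    (π : X.carrier → Y.carrier) (ν : Measure Y.carrier) : Set (Measure X.carrier) :=
  {μ | IsProbabilityMeasure μ ∧ Ergodic (shiftMap X) μ ∧ μ.map π = ν}

end FactorCode

end

/-!
The degree. Passing to blocks and to the subset construction, a sofic shift `X` is the image of the
space of bi-infinite paths of a finite graph which is deterministic (`coverGraph`), such that `π`
becomes a map `l` on the vertices. Let `y₀` be a sequence over which the set `S` of vertices at time
`0` of the paths is as small as possible. By compactness a finite window of `y₀` forces this set to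
be `S` for every sequence containing the window (`exists_magic_window`). Between two occurrences
`n < m` of this window in `y`, the vertex at time `n` determines the path over `y` up to time `m`
(`eq_of_eq_left`): each segment over `[n, m)` can be prolonged in both directions by further
segments over the same labels, since each of them starts and ends in `S`, and two distinct segments
with the same first vertex could be prolonged to distinct paths with the same past and the same
periodic label sequence. The fibre of `π` over a periodic point is finite and invariant under a
power of the shift, so that its points with the same past coincide. Hence, if `y` and `y'` are
doubly transitive, the finitely many points over `y`, which differ between two magic windows far
apart, are copied by distinct points over `y'`, at a place where `y'` repeats this part of `y`
(`encard_fibre_le`). By symmetry the fibres over `y` and `y'` have the same cardinality.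

The joinings. By recurrence and ergodicity, `ν`-almost every point is doubly transitive, so almost
every fibre has `d` points, where `d` is the degree. The counting measure `fibreMeasure π y` on the
fibre depends measurably on `y`, and averaging the counting measures on the `d`-tuples of distinct
points of the fibres gives an invariant measure. Its invariant sets have measure zero or at least
one, which yields an ergodic component (`exists_ergodic_separating`). Conversely, almost every tuple
of any degree joining enumerates a whole fibre. So the sum of the margins is the average of the
measures `fibreMeasure π y` for every degree joining (`sum_margins_eq_bind`). The margins are
ergodic, and distinct ergodic measures are mutually singular, so this sum determines the number of
times that each measure occurs among the margins (`card_eq_card_of_sum_eq`). Each ergodic lift of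
`ν` is absolutely continuous with respect to the sum, hence is a margin, and counting the `d`
margins by their values gives the formula.
-/

namespace FactorCode
open Set Filter

section Ergodic

/-! ### Ergodic measures -/

variable {X : Type*} [MeasurableSpace X]

/-- The absolutely continuous part of `μ` with respect to `μ'` is invariant, hence a multiple of
both measures, and they are distinct. -/
theorem mutuallySingular_of_ergodic_of_ne {T : X → X} {μ μ' : Measure X} [IsProbabilityMeasure μ]
    [IsProbabilityMeasure μ'] (h : Ergodic T μ) (h' : Ergodic T μ') (hne : μ ≠ μ') :
    μ ⟂ₘ μ' := by
  have hinv := h.toMeasurePreserving.withDensity_rnDeriv h'.toMeasurePreserving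
  have hle : μ'.withDensity (μ.rnDeriv μ') ≤ μ := Measure.withDensity_rnDeriv_le _ _
  have : IsFiniteMeasure (μ'.withDensity (μ.rnDeriv μ')) := isFiniteMeasure_of_le _ hle
  obtain ⟨c, hc⟩ := h'.eq_smul_of_absolutelyContinuous hinv (withDensity_absolutelyContinuous _ _)
  obtain ⟨c', hc'⟩ := h.eq_smul_of_absolutelyContinuous hinv hle.absolutelyContinuous
  have hcc : c = c' := by
    have h1 := congrArg (fun m : Measure X => m univ) (hc.symm.trans hc')
    simpa using h1
  subst hcc
  have hctop : c ≠ ⊤ := by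
    have h1 := congrArg (fun m : Measure X => m univ) hc
    simp only [Measure.smul_apply, measure_univ, smul_eq_mul, mul_one] at h1
    exact h1 ▸ measure_ne_top _ _
  rw [← Measure.withDensity_rnDeriv_eq_zero]
  by_cases h0 : c = 0
  · rw [hc, h0, zero_smul]
  · refine absurd ?_ hne
    ext s hs
    have h1 := congrArg (fun m : Measure X => m s) (hc.symm.trans hc')
    simp only [Measure.smul_apply, smul_eq_mul] at h1
    exact ((ENNReal.mul_right_inj h0 hctop).1 h1).symm

/-- If the invariant sets of positive measure have measure bounded away from zero, then one of
almost minimal measure cannot be split, so that conditioning on it gives an ergodic measure. -/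
theorem exists_ergodic_cond {T : X → X} {ρ : Measure X} [IsFiniteMeasure ρ]
    (hT : MeasurePreserving T ρ ρ) {c : ENNReal} (hc : c ≠ 0) (huniv : ρ univ ≠ 0)
    (h : ∀ E, MeasurableSet E → T ⁻¹' E = E → ρ E ≠ 0 → c ≤ ρ E) :
    ∃ E, ρ E ≠ 0 ∧ Ergodic T (ProbabilityTheory.cond ρ E) := by
  set 𝓔 : Set (Set X) := {E | MeasurableSet E ∧ T ⁻¹' E = E ∧ ρ E ≠ 0} with h𝓔
  set m := ⨅ E ∈ 𝓔, ρ E with hm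
  have hmc : c ≤ m := le_iInf₂ fun E hE => h E hE.1 hE.2.1 hE.2.2
  have hm0 : m ≠ 0 := fun h0 => hc (le_antisymm (h0 ▸ hmc) zero_le)
  have hmtop : m ≠ ⊤ := ne_top_of_le_ne_top (measure_ne_top ρ univ)
    (iInf₂_le univ ⟨MeasurableSet.univ, preimage_univ, huniv⟩)
  have hlt : m < 2 * m := by
    rw [two_mul]
    exact ENNReal.lt_add_right hmtop hm0
  obtain ⟨E, hE, hElt⟩ : ∃ E ∈ 𝓔, ρ E < 2 * m := by
    by_contra! hcon
    exact absurd (le_iInf₂ hcon) (not_le.2 hlt)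
  refine ⟨E, hE.2.2, ⟨⟨hT.measurable, ?_⟩, ⟨fun s hs hTs => ?_⟩⟩⟩
  · have := hT.restrict_preimage hE.1
    rw [hE.2.1] at this
    rw [ProbabilityTheory.cond, Measure.map_smul, this.map_eq]
  · rw [eventuallyConst_set]
    by_contra! hcon
    have h1 : E ∩ s ∈ 𝓔 := by
      refine ⟨hE.1.inter hs, by rw [preimage_inter, hE.2.1, hTs], fun h0 => ?_⟩
      rw [frequently_ae_mem_iff, ProbabilityTheory.cond_apply hE.1, h0, mul_zero] at hcon
      exact hcon.2 rfl
    have h2 : E ∩ sᶜ ∈ 𝓔 := by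
      refine ⟨hE.1.inter hs.compl, by rw [preimage_inter, hE.2.1, preimage_compl, hTs],
        fun h0 => ?_⟩
      have h6 : ∃ᵐ x ∂ProbabilityTheory.cond ρ E, x ∈ sᶜ := hcon.1
      rw [frequently_ae_mem_iff, ProbabilityTheory.cond_apply hE.1, h0, mul_zero] at h6
      exact h6 rfl
    have h3 : m ≤ ρ (E ∩ s) := iInf₂_le _ h1
    have h4 : m ≤ ρ (E ∩ sᶜ) := iInf₂_le _ h2
    have h5 : ρ (E ∩ s) + ρ (E ∩ sᶜ) = ρ E := by
      rw [← sdiff_eq]; exact measure_inter_add_sdiff E hs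
    rw [← h5, two_mul] at hElt
    exact absurd (add_le_add h3 h4) (not_le.2 hElt)

/-- Distinct ergodic measures are mutually singular, so each of them is determined, with its
multiplicity, by the sum of a finite family. -/
theorem card_eq_card_of_sum_eq {T : X → X} {n : ℕ} {p q : Fin n → Measure X} {μ : Measure X}
    [∀ i, IsProbabilityMeasure (p i)] [∀ i, IsProbabilityMeasure (q i)] [IsProbabilityMeasure μ]
    (hp : ∀ i, Ergodic T (p i)) (hq : ∀ i, Ergodic T (q i)) (hμ : Ergodic T μ)
    (hpq : ∑ i, p i = ∑ i, q i) :
    {i | p i = μ}.ncard = {i | q i = μ}.ncard := by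
  classical
  have hex : ∃ s, MeasurableSet s ∧ μ s = 1 ∧ (∀ i, p i ≠ μ → p i s = 0) ∧
      ∀ i, q i ≠ μ → q i s = 0 := by
    let r : Fin n ⊕ Fin n → Measure X := Sum.elim p q
    have hr : μ ⟂ₘ Measure.sum fun j : {j // r j ≠ μ} => r j := by
      rw [Measure.MutuallySingular.sum_right]
      rintro ⟨i | i, hi⟩
      · exact mutuallySingular_of_ergodic_of_ne (μ' := p i) hμ (hp i) (Ne.symm hi)
      · exact mutuallySingular_of_ergodic_of_ne (μ' := q i) hμ (hq i) (Ne.symm hi)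
    obtain ⟨t, ht, ht0, ht1⟩ := hr
    rw [Measure.sum_apply _ ht.compl, ENNReal.tsum_eq_zero] at ht1
    exact ⟨tᶜ, ht.compl, by rw [prob_compl_eq_one_iff ht, ht0], fun i hi => ht1 ⟨Sum.inl i, hi⟩,
      fun i hi => ht1 ⟨Sum.inr i, hi⟩⟩
  obtain ⟨s, hs, h1, h2, h3⟩ := hex
  have key (r : Fin n → Measure X) (hr : ∀ i, r i ≠ μ → r i s = 0) :
      (∑ i, r i) s = {i | r i = μ}.ncard := by
    have h4 (i : Fin n) : r i s = if r i = μ then 1 else 0 := by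
      split_ifs with h
      · rw [h, h1]
      · exact hr i h
    rw [Measure.finsetSum_apply, Finset.sum_congr rfl fun i _ => h4 i, ncard_eq_toFinset_card']
    simp
  have := (key p h2).symm.trans ((congrArg (fun m : Measure X => m s) hpq).trans (key q h3))
  exact_mod_cast this

theorem exists_eq_of_absolutelyContinuous_sum {T : X → X} {n : ℕ} {p : Fin n → Measure X}
    {μ : Measure X} [∀ i, IsProbabilityMeasure (p i)] [IsProbabilityMeasure μ]
    (hp : ∀ i, Ergodic T (p i)) (hμ : Ergodic T μ) (h : μ ≪ ∑ i, p i) : ∃ i, p i = μ := by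
  by_contra! hne
  have hs : μ ⟂ₘ Measure.sum p := Measure.MutuallySingular.sum_right.2 fun i =>
    mutuallySingular_of_ergodic_of_ne hμ (hp i) (hne i).symm
  rw [Measure.sum_fintype] at hs
  exact IsProbabilityMeasure.ne_zero μ
    (Measure.eq_zero_of_absolutelyContinuous_of_mutuallySingular h hs)

end Ergodic

section Fibre

/-! ### Counting measure on the fibres -/

variable {X Y : Type*} [MeasurableSpace X] [MeasurableSingletonClass X] {π : X → Y}

/-- The counting measure on the fibre of `π` over `y`. -/
noncomputable def fibreMeasure (π : X → Y) (y : Y) : Measure X :=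
  Measure.count.restrict (π ⁻¹' {y})

/-- The counting measure on the `n`-tuples of points of the fibre of `π` over `y`. -/
noncomputable def fibreTupleMeasure (π : X → Y) (n : ℕ) (y : Y) : Measure (Fin n → X) :=
  Measure.pi fun _ => fibreMeasure π y

theorem fibreMeasure_apply (hfin : ∀ y, (π ⁻¹' {y}).Finite) (y : Y) {s : Set X}
    (hs : MeasurableSet s) :
    fibreMeasure π y s = (s ∩ π ⁻¹' {y}).encard := by
  rw [fibreMeasure, Measure.restrict_apply hs,
    Measure.count_apply (hs.inter (hfin y).measurableSet)]

theorem isFiniteMeasure_fibreMeasure (hfin : ∀ y, (π ⁻¹' {y}).Finite) (y : Y) :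
    IsFiniteMeasure (fibreMeasure π y) := by
  refine ⟨?_⟩
  rw [fibreMeasure_apply hfin y MeasurableSet.univ, univ_inter]
  simpa using hfin y

theorem ae_fibreMeasure (hfin : ∀ y, (π ⁻¹' {y}).Finite) (y : Y) :
    ∀ᵐ x ∂fibreMeasure π y, π x = y :=
  ae_restrict_mem (hfin y).measurableSet

theorem fibreMeasure_singleton (hfin : ∀ y, (π ⁻¹' {y}).Finite) {x : X} {y : Y} (hx : π x = y) :
    fibreMeasure π y {x} = 1 := by
  rw [fibreMeasure_apply hfin y (measurableSet_singleton x),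
    inter_eq_left.2 (by simpa using hx), encard_singleton]
  simp

theorem map_fibreMeasure (hfin : ∀ y, (π ⁻¹' {y}).Finite) (e : X ≃ᵐ X) {f : Y → Y}
    (hf : Function.Injective f) (hsemi : ∀ x, π (e x) = f (π x)) (y : Y) :
    (fibreMeasure π y).map e = fibreMeasure π (f y) := by
  ext s hs
  rw [e.map_apply, fibreMeasure_apply hfin _ (e.measurable hs), fibreMeasure_apply hfin _ hs,
    ← e.injective.encard_image]
  congr 2
  ext x
  constructor
  · rintro ⟨x, ⟨h1, h2⟩, rfl⟩
    exact ⟨h1, by simpa [hsemi] using congrArg f h2⟩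
  · rintro ⟨h1, h2⟩
    refine ⟨e.symm x, ⟨by simpa using h1, hf ?_⟩, by simp⟩
    rw [← hsemi]
    simpa using h2

theorem map_fibreTupleMeasure (hfin : ∀ y, (π ⁻¹' {y}).Finite) (e : X ≃ᵐ X) {f : Y → Y}
    (hf : Function.Injective f) (hsemi : ∀ x, π (e x) = f (π x)) (n : ℕ) (y : Y) :
    (fibreTupleMeasure π n y).map (fun x i => e (x i)) = fibreTupleMeasure π n (f y) := by
  have := isFiniteMeasure_fibreMeasure hfin
  have h1 := map_fibreMeasure hfin e hf hsemi y
  have : SigmaFinite ((fibreMeasure π y).map e) := by rw [h1]; infer_instance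
  unfold fibreTupleMeasure
  rw [Measure.pi_map_pi fun _ => e.measurable.aemeasurable]
  simp_rw [h1]

theorem ae_fibreTupleMeasure (hfin : ∀ y, (π ⁻¹' {y}).Finite) (n : ℕ) (y : Y) :
    ∀ᵐ x ∂fibreTupleMeasure π n y, ∀ i, π (x i) = y := by
  have := isFiniteMeasure_fibreMeasure hfin
  exact eventually_all.2 fun i =>
    (Measure.tendsto_eval_ae_ae (μ := fun _ : Fin n => fibreMeasure π y) (i := i)).eventually
      (ae_fibreMeasure hfin y)

/-- A nonnegligible set of tuples contains a tuple over `y`, and each of these has mass `1`. -/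
theorem one_le_fibreTupleMeasure (hfin : ∀ y, (π ⁻¹' {y}).Finite) {n : ℕ} {y : Y}
    {s : Set (Fin n → X)} (hs : fibreTupleMeasure π n y s ≠ 0) : 1 ≤ fibreTupleMeasure π n y s := by
  have := isFiniteMeasure_fibreMeasure hfin
  obtain ⟨x, hx, hxs⟩ :=
    ((frequently_ae_mem_iff.2 hs).and_eventually (ae_fibreTupleMeasure hfin n y)).exists
  calc (1 : ENNReal) = fibreTupleMeasure π n y {x} := by
        rw [fibreTupleMeasure, Measure.pi_singleton]
        simp [fibreMeasure_singleton hfin (hxs _)]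
    _ ≤ _ := measure_mono (by simpa using hx)

variable [MeasurableSpace Y]

theorem measurable_fibreTupleMeasure (hfin : ∀ y, (π ⁻¹' {y}).Finite)
    (hκ : Measurable (fibreMeasure π)) (n : ℕ) :
    Measurable (fibreTupleMeasure π n) := by
  have := isFiniteMeasure_fibreMeasure hfin
  have (y : Y) : IsFiniteMeasure (fibreTupleMeasure π n y) := by
    unfold fibreTupleMeasure; infer_instance
  have key (t : Fin n → Set X) (ht : ∀ i, MeasurableSet (t i)) :
      Measurable fun y => fibreTupleMeasure π n y (univ.pi t) := by
    simp only [fibreTupleMeasure, Measure.pi_pi]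
    exact Finset.measurable_fun_prod _ fun i _ => (Measure.measurable_coe (ht i)).comp hκ
  refine Measurable.measure_of_isPiSystem generateFrom_pi.symm isPiSystem_pi ?_ ?_
  · rintro _ ⟨t, ht, rfl⟩
    exact key t fun i => ht i (mem_univ i)
  · simpa using key (fun _ => univ) fun _ => MeasurableSet.univ

/-! ### Existence of an ergodic separating joining -/

/-- Averaging the counting measures on the tuples of distinct points of the fibres gives an
invariant measure. The points over which an invariant set contains a tuple form an invariant set;
if it is not negligible, it has full measure by ergodicity of `ν`. Hence a nonnegligible invariant
set of tuples has measure at least one, and conditioning on one of almost minimal measure gives an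
ergodic measure. -/
theorem exists_ergodic_separating [MeasurableEq X] [MeasurableEq Y] (hfin : ∀ y, (π ⁻¹' {y}).Finite)
    (hκ : Measurable (fibreMeasure π)) (hπ : Measurable π) (e : X ≃ᵐ X) {f : Y → Y}
    (hf : Function.Injective f) (hsemi : ∀ x, π (e x) = f (π x)) {ν : Measure Y}
    [IsProbabilityMeasure ν] (hν : Ergodic f ν) {d : ℕ} (hd : ∀ᵐ y ∂ν, (π ⁻¹' {y}).ncard = d) :
    ∃ ρ : Measure (Fin d → X), IsProbabilityMeasure ρ ∧ Ergodic (fun x i => e (x i)) ρ ∧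
      (∀ᵐ x ∂ρ, Function.Injective x) ∧ (∀ i, ρ.map (fun x => π (x i)) = ν) ∧
      ∀ᵐ x ∂ρ, ∀ i j, π (x i) = π (x j) := by
  have hκd := measurable_fibreTupleMeasure hfin hκ d
  have := isFiniteMeasure_fibreMeasure hfin
  set T : (Fin d → X) → Fin d → X := fun x i => e (x i) with hT
  have hTm : Measurable T := by fun_prop
  set I : Set (Fin d → X) := {x | Function.Injective x} with hI
  have hIm : MeasurableSet I := by
    have : I = ⋂ i, ⋂ j, {x | x i = x j → i = j} := by
      ext x; simp [hI, Function.Injective]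
    rw [this]
    refine MeasurableSet.iInter fun i => MeasurableSet.iInter fun j => ?_
    by_cases hij : i = j
    · simp [hij]
    · simp only [hij, imp_false]
      exact (measurableSet_eq_fun (measurable_pi_apply i) (measurable_pi_apply j)).compl
  have hTI : T ⁻¹' I = I := by
    ext x
    exact ⟨fun h i j hij => h (congrArg e hij), fun h => e.injective.comp h⟩
  set ρ₀ := ν.bind (fibreTupleMeasure π d) with hρ₀
  have hρ₀_apply {s : Set (Fin d → X)} (hs : MeasurableSet s) :
      ρ₀ s = ∫⁻ y, fibreTupleMeasure π d y s ∂ν := Measure.bind_apply hs hκd.aemeasurable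
  have hinv₀ : MeasurePreserving T ρ₀ ρ₀ := by
    refine ⟨hTm, ?_⟩
    ext s hs
    rw [Measure.map_apply hTm hs, hρ₀_apply (hTm hs), hρ₀_apply hs]
    rw [← hν.toMeasurePreserving.lintegral_comp (f := fun y => fibreTupleMeasure π d y s)
      ((Measure.measurable_coe hs).comp hκd)]
    refine lintegral_congr fun y => ?_
    rw [← map_fibreTupleMeasure hfin e hf hsemi, Measure.map_apply hTm hs]
  set ρ := ρ₀.restrict I with hρ
  have hinv : MeasurePreserving T ρ ρ := by
    have := hinv₀.restrict_preimage hIm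
    rwa [hTI] at this
  have hρ_apply {s : Set (Fin d → X)} (hs : MeasurableSet s) :
      ρ s = ∫⁻ y, fibreTupleMeasure π d y (s ∩ I) ∂ν := by
    rw [hρ, Measure.restrict_apply hs, hρ₀_apply (hs.inter hIm)]
  have hmeas {s : Set (Fin d → X)} (hs : MeasurableSet s) :
      Measurable fun y => fibreTupleMeasure π d y s := (Measure.measurable_coe hs).comp hκd
  have huniv : ρ univ ≠ 0 := by
    rw [hρ_apply MeasurableSet.univ, univ_inter, Ne, lintegral_eq_zero_iff (hmeas hIm)]
    intro h0
    obtain ⟨y, hy0, hyd⟩ := (h0.and hd).exists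
    have : Nat.card (π ⁻¹' {y}) = d := hyd
    have := (hfin y).to_subtype
    let eq := (Finite.equivFinOfCardEq ‹Nat.card (π ⁻¹' {y}) = d›).symm
    have hmem : (fun i => (eq i : X)) ∈ I := Subtype.val_injective.comp eq.injective
    have : (1 : ENNReal) ≤ fibreTupleMeasure π d y I := by
      calc (1 : ENNReal) = fibreTupleMeasure π d y {fun i => (eq i : X)} := by
            rw [fibreTupleMeasure, Measure.pi_singleton]
            simp [fibreMeasure_singleton hfin (eq _).2]
        _ ≤ _ := measure_mono (by simpa using hmem)
    exact absurd (this.trans_eq hy0) (by simp)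
  have hρfin : IsFiniteMeasure ρ := by
    refine ⟨?_⟩
    calc ρ univ ≤ ρ₀ univ := Measure.restrict_apply_le _ _
      _ = ∫⁻ y, fibreTupleMeasure π d y univ ∂ν := hρ₀_apply MeasurableSet.univ
      _ = ∫⁻ _, (d : ENNReal) ^ d ∂ν := by
          refine lintegral_congr_ae (hd.mono fun y hy => ?_)
          simp only [fibreTupleMeasure, Measure.pi_univ]
          simp [fibreMeasure_apply hfin y MeasurableSet.univ, ← (hfin y).cast_ncard_eq, hy]
      _ < ⊤ := by simp
  have hone (E : Set (Fin d → X)) (hE : MeasurableSet E) (hTE : T ⁻¹' E = E) (h0 : ρ E ≠ 0) :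
      1 ≤ ρ E := by
    set D : Set Y := {y | fibreTupleMeasure π d y (E ∩ I) ≠ 0} with hD
    have hDm : MeasurableSet D :=
      (hmeas (hE.inter hIm)) (measurableSet_singleton 0).compl
    have hDinv : f ⁻¹' D = D := by
      ext y
      simp only [hD, mem_preimage, mem_ofPred_eq]
      rw [← map_fibreTupleMeasure hfin e hf hsemi, Measure.map_apply hTm (hE.inter hIm),
        preimage_inter, hTE, hTI]
    rw [hρ_apply hE] at h0 ⊢
    rcases hν.toPreErgodic.ae_mem_or_ae_notMem hDm hDinv with h1 | h1
    · calc (1 : ENNReal) = ∫⁻ _, 1 ∂ν := by simp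
        _ ≤ _ := lintegral_mono_ae (h1.mono fun y hy => one_le_fibreTupleMeasure hfin hy)
    · refine absurd ?_ h0
      rw [lintegral_eq_zero_iff (hmeas (hE.inter hIm))]
      exact h1.mono fun y hy => by simpa [hD] using hy
  obtain ⟨E, hE0, hErg⟩ := exists_ergodic_cond hinv one_ne_zero huniv hone
  have hprob := ProbabilityTheory.cond_isProbabilityMeasure hE0
  have habs : ProbabilityTheory.cond ρ E ≪ ρ := ProbabilityTheory.cond_absolutelyContinuous
  refine ⟨ProbabilityTheory.cond ρ E, hprob, hErg, ?_, fun i => ?_, ?_⟩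
  · exact habs.ae_le (ae_restrict_mem hIm)
  · have hm : Measurable fun x : Fin d → X => π (x i) := hπ.comp (measurable_pi_apply i)
    have := Measure.isProbabilityMeasure_map (μ := ProbabilityTheory.cond ρ E) hm.aemeasurable
    -- the image is invariant and absolutely continuous, so it is `ν` by ergodicity
    refine hν.eq_of_absolutelyContinuous ?_ ?_
    · exact (hm.measurePreserving _).of_semiconj hErg.toMeasurePreserving (fun x => hsemi _)
        hν.measurable
    · refine Measure.AbsolutelyContinuous.mk fun s hs h0 => ?_
      rw [Measure.map_apply hm hs]
      refine habs (Measure.absolutelyContinuous_of_le Measure.restrict_le_self ?_)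
      rw [hρ₀_apply (hm hs), lintegral_eq_zero_iff (hmeas (hm hs))]
      filter_upwards [measure_eq_zero_iff_ae_notMem.1 h0] with y hy
      refine measure_eq_zero_iff_ae_notMem.2 ?_
      filter_upwards [ae_fibreTupleMeasure hfin d y] with x hx hxs
      exact hy (by simpa [hx i] using hxs)
  · have hm : MeasurableSet {x : Fin d → X | ∀ i j, π (x i) = π (x j)} := by
      simp only [ofPred_forall]
      exact MeasurableSet.iInter fun i => MeasurableSet.iInter fun j =>
        measurableSet_eq_fun (hπ.comp (measurable_pi_apply i)) (hπ.comp (measurable_pi_apply j))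
    refine habs (Measure.absolutelyContinuous_of_le Measure.restrict_le_self ?_)
    change ρ₀ {x : Fin d → X | ∀ i j, π (x i) = π (x j)}ᶜ = 0
    rw [hρ₀_apply hm.compl, lintegral_eq_zero_iff (hmeas hm.compl)]
    refine Eventually.of_forall fun y => ?_
    exact (ae_fibreTupleMeasure hfin d y).mono fun x hx i j => (hx i).trans (hx j).symm

/-! ### The margins of a separating joining -/

/-- Almost every tuple enumerates a whole fibre, so that the margins add up to the average of the
counting measures on the fibres; in particular their sum does not depend on the joining. -/
theorem sum_margins_eq_bind (hfin : ∀ y, (π ⁻¹' {y}).Finite) (hκ : Measurable (fibreMeasure π))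
    (hπ : Measurable π) {ν : Measure Y} {d : ℕ} (hd : ∀ᵐ y ∂ν, (π ⁻¹' {y}).ncard = d)
    {ρ : Measure (Fin d → X)} (hinj : ∀ᵐ x ∂ρ, Function.Injective x)
    (hsame : ∀ᵐ x ∂ρ, ∀ i j, π (x i) = π (x j)) (i₀ : Fin d)
    (him : ρ.map (fun x => π (x i₀)) = ν) :
    ∑ i, ρ.map (fun x => x i) = ν.bind (fibreMeasure π) := by
  have hm : Measurable fun x : Fin d → X => π (x i₀) := hπ.comp (measurable_pi_apply i₀)
  ext s hs
  have hκs : Measurable fun y => fibreMeasure π y s := (Measure.measurable_coe hs).comp hκ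
  rw [Measure.bind_apply hs hκ.aemeasurable, ← him, lintegral_map hκs hm, Measure.finsetSum_apply]
  have h1 (i : Fin d) : ρ.map (fun x => x i) s = ∫⁻ x, s.indicator 1 (x i) ∂ρ := by
    rw [← lintegral_indicator_one hs, lintegral_map (measurable_one.indicator hs)
      (measurable_pi_apply i)]
  simp_rw [h1]
  rw [← lintegral_finsetSum (f := fun i (x : Fin d → X) => s.indicator 1 (x i)) _ fun i _ =>
    (measurable_one.indicator hs).comp (measurable_pi_apply i)]
  rw [← him] at hd
  refine lintegral_congr_ae ?_
  filter_upwards [hinj, hsame, ae_of_ae_map hm.aemeasurable hd] with x hx hxs hxd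
  have hrange : range x = π ⁻¹' {π (x i₀)} := by
    refine Set.eq_of_subset_of_ncard_le ?_ ?_ (hfin _)
    · rintro _ ⟨i, rfl⟩
      exact hxs i i₀
    · rw [hxd, ← image_univ, ncard_image_of_injective _ hx]
      simp
  rw [fibreMeasure_apply hfin _ hs, ← hrange, ← image_preimage_eq_inter_range, hx.encard_image]
  classical
  rw [encard_eq_coe_toFinset_card]
  simp [indicator_apply]

/-- Every lift of `ν` is absolutely continuous with respect to the average of the counting measures
on the fibres. -/
theorem absolutelyContinuous_bind_fibreMeasure (hfin : ∀ y, (π ⁻¹' {y}).Finite)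
    (hκ : Measurable (fibreMeasure π)) (hπ : Measurable π) (μ : Measure X) :
    μ ≪ (μ.map π).bind (fibreMeasure π) := by
  refine Measure.AbsolutelyContinuous.mk fun s hs h0 => ?_
  have hκs : Measurable fun y => fibreMeasure π y s := (Measure.measurable_coe hs).comp hκ
  rw [Measure.bind_apply hs hκ.aemeasurable, lintegral_eq_zero_iff hκs] at h0
  refine measure_eq_zero_iff_ae_notMem.2 ?_
  filter_upwards [ae_of_ae_map hπ.aemeasurable h0] with x hx hxs
  rw [fibreMeasure_apply hfin _ hs] at hx
  have : (s ∩ π ⁻¹' {π x}).encard = 0 := by simpa using hx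
  exact notMem_empty x (encard_eq_zero.1 this ▸ ⟨hxs, rfl⟩)

end Fibre

section Path

variable {V A B : Type*}

/-! ### Bi-infinite paths in a finite graph -/

/-- Compactness: a constraint on consecutive vertices which can be satisfied on all finite windows
can be satisfied everywhere. -/
theorem exists_int_sequence_of_forall_window [Finite V] (C : ℤ → V → V → Prop)
    (h : ∀ N : ℕ, ∃ z : ℤ → V, ∀ i, |i| ≤ (N : ℤ) → C i (z i) (z (i + 1))) :
    ∃ z : ℤ → V, ∀ i, C i (z i) (z (i + 1)) := by
  let _ : TopologicalSpace V := ⊥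
  have : DiscreteTopology V := ⟨rfl⟩
  let Q : ℕ → Set (ℤ → V) := fun N => {z | ∀ i, |i| ≤ (N : ℤ) → C i (z i) (z (i + 1))}
  have hcl (N : ℕ) : IsClosed (Q N) := by
    simp only [Q, ofPred_forall]
    refine isClosed_iInter fun i => isClosed_iInter fun _ => ?_
    exact (isClosed_discrete {v : V × V | C i v.1 v.2}).preimage
      (f := fun z : ℤ → V => (z i, z (i + 1))) (by fun_prop)
  obtain ⟨z, hz⟩ := IsCompact.nonempty_iInter_of_sequence_nonempty_isCompact_isClosed Q
    (fun N z hz i hi => hz i (hi.trans (by push_cast; omega))) h (hcl 0).isCompact hcl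
  rw [mem_iInter] at hz
  exact ⟨z, fun i => hz i.natAbs i (by simp)⟩

/-- The bi-infinite paths in the graph `E` whose sequence of labels is `y`. -/
def pathFibre (E : V → V → Prop) (l : V → B) (y : ℤ → B) : Set (ℤ → V) :=
  {z | (∀ i, E (z i) (z (i + 1))) ∧ ∀ i, l (z i) = y i}

theorem shift_mem_pathFibre {E : V → V → Prop} {l : V → B} {y : ℤ → B} {z : ℤ → V}
    (hz : z ∈ pathFibre E l y) (n : ℤ) :
    (fun i => z (n + i)) ∈ pathFibre E l fun i => y (n + i) :=
  ⟨fun i => by simpa [add_assoc] using hz.1 (n + i), fun i => hz.2 _⟩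

/-- `y` agrees with `y₀` on the window of radius `N` around `n`. -/
def AgreesAt (y₀ : ℤ → B) (N : ℕ) (y : ℤ → B) (n : ℤ) : Prop :=
  ∀ i, |i| ≤ (N : ℤ) → y (n + i) = y₀ i

/-- There is a magic window, that is, a window such that the paths over a sequence containing it at
`n` pass at time `n` through exactly the same vertices, for all sequences. It is found around a time
at which the number of vertices is as small as possible. -/
theorem exists_magic_window [Finite V] {E : V → V → Prop} {l : V → B} {z₀ : ℤ → V}
    (hz₀ : ∀ i, E (z₀ i) (z₀ (i + 1))) :
    ∃ (y₀ : ℤ → B) (N : ℕ) (S : Set V), (pathFibre E l y₀).Nonempty ∧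
      ∀ y n, (pathFibre E l y).Nonempty → AgreesAt y₀ N y n →
        (fun z => z n) '' pathFibre E l y = S := by
  let st (y : ℤ → B) : Set V := (fun z => z 0) '' pathFibre E l y
  obtain ⟨y₀, hy₀, hmin⟩ : ∃ y₀, (pathFibre E l y₀).Nonempty ∧
      ∀ y, (pathFibre E l y).Nonempty → (st y₀).ncard ≤ (st y).ncard := by
    have hne : {y | (pathFibre E l y).Nonempty}.Nonempty :=
      ⟨fun i => l (z₀ i), z₀, hz₀, fun _ => rfl⟩
    refine ⟨Function.argminOn (fun y => (st y).ncard) _ hne, Function.argminOn_mem _ _ hne, ?_⟩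
    intro y hy
    exact Function.argminOn_le (fun y => (st y).ncard) _ hy
  have hN : ∃ N : ℕ, ∀ y, AgreesAt y₀ N y 0 → st y ⊆ st y₀ := by
    by_contra! hcon
    have := exists_int_sequence_of_forall_window
      (fun i v w => E v w ∧ l v = y₀ i ∧ (i = 0 → v ∉ st y₀)) fun N => by
        obtain ⟨y, hy, hsub⟩ := hcon N
        obtain ⟨_, ⟨z, hz, rfl⟩, hzS⟩ := not_subset.1 hsub
        refine ⟨z, fun i hi => ⟨hz.1 i, ?_, ?_⟩⟩
        · rw [hz.2, ← hy i hi, zero_add]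
        · rintro rfl
          exact hzS
    obtain ⟨z, hz⟩ := this
    exact (hz 0).2.2 rfl ⟨z, ⟨fun i => (hz i).1, fun i => (hz i).2.1⟩, rfl⟩
  obtain ⟨N, hN⟩ := hN
  refine ⟨y₀, N, st y₀, hy₀, fun y n ⟨z, hz⟩ hyn => ?_⟩
  have h1 : st (fun i => y (n + i)) = st y₀ := by
    refine Set.eq_of_subset_of_ncard_le (hN _ fun i hi => ?_)
      (hmin _ ⟨_, shift_mem_pathFibre hz n⟩) (toFinite _)
    simpa using hyn i hi
  rw [← h1]
  ext v
  constructor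
  · rintro ⟨z, hz, rfl⟩
    exact ⟨_, shift_mem_pathFibre hz n, by simp⟩
  · rintro ⟨z, hz, rfl⟩
    refine ⟨_, by simpa using shift_mem_pathFibre hz (-n), by simp⟩

/-- Concatenation of the segments `w t`, restricted to `[n, n + p)`, along `t : ℤ`. -/
def concat (n p : ℤ) (w : ℤ → ℤ → V) (i : ℤ) : V :=
  w ((i - n) / p) (n + (i - n) % p)

theorem concat_isPath {E : V → V → Prop} {n p : ℤ} (hp : 0 < p) {w : ℤ → ℤ → V}
    (hw : ∀ t i, E (w t i) (w t (i + 1))) (hjoin : ∀ t, w t (n + p) = w (t + 1) n) (i : ℤ) :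
    E (concat n p w i) (concat n p w (i + 1)) := by
  unfold concat
  have h0 := Int.emod_nonneg (i - n) hp.ne'
  have h1 := Int.emod_lt_of_pos (i - n) hp
  have h2 := Int.emod_add_mul_ediv (i - n) p
  set q := (i - n) / p
  set r := (i - n) % p
  have h3 : i + 1 - n = (r + 1) + p * q := by linarith
  have h := hw q (n + r)
  rcases (show r + 1 ≤ p by omega).lt_or_eq with h4 | h4
  · rw [h3, Int.add_mul_ediv_left _ _ hp.ne', Int.add_mul_emod_self_left,
      Int.ediv_eq_zero_of_lt (by omega) h4, Int.emod_eq_of_lt (by omega) h4, zero_add, ← add_assoc]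
    exact h
  · rw [h3, Int.add_mul_ediv_left _ _ hp.ne', Int.add_mul_emod_self_left, h4,
      Int.ediv_self hp.ne', Int.emod_self, add_zero, add_comm 1 q, ← hjoin]
    rwa [add_assoc, h4] at h

theorem label_concat {l : V → B} {n p : ℤ} (hp : 0 < p) {w : ℤ → ℤ → V} {y : ℤ → B}
    (hw : ∀ t i, n ≤ i → i < n + p → l (w t i) = y i) (i : ℤ) :
    l (concat n p w i) = y (n + (i - n) % p) :=
  hw _ _ (by linarith [Int.emod_nonneg (i - n) hp.ne'])
    (by linarith [Int.emod_lt_of_pos (i - n) hp])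

/-- Two paths over sequences which agree on `[n, m)`, and both contain a magic window at `n` and at
`m`, agree on `[n, m)` if they meet at time `n`. Indeed they can be prolonged, by concatenating
paths over the same segment of `y`, to paths with the same periodic label sequence and the same
past. The hypothesis `H` says that such paths are equal. -/
theorem eq_of_eq_left {E : V → V → Prop} {l : V → B}
    (H : ∀ p > 0, ∀ z z' : ℤ → V, (∀ i, E (z i) (z (i + 1))) → (∀ i, E (z' i) (z' (i + 1))) →
      (∀ i, l (z i) = l (z' i)) → (∀ i, l (z (i + p)) = l (z i)) →
      ∀ n, (∀ i < n, z i = z' i) → z = z')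
    {S : Set V} {y y' : ℤ → B} {n m : ℤ} (hnm : n < m) (hyy' : ∀ i, n ≤ i → i < m → y' i = y i)
    (hn : (fun z => z n) '' pathFibre E l y = S) (hm : (fun z => z m) '' pathFibre E l y = S)
    (hm' : (fun z => z m) '' pathFibre E l y' = S)
    {z z' : ℤ → V} (hz : z ∈ pathFibre E l y) (hz' : z' ∈ pathFibre E l y') (hzz' : z n = z' n)
    (i : ℤ) (hni : n ≤ i) (him : i < m) : z i = z' i := by
  obtain ⟨p, hp, rfl⟩ : ∃ p > 0, m = n + p := ⟨m - n, by omega, by omega⟩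
  -- the paths whose segment on `[n, m)` may be used in a concatenation
  let W : Set (ℤ → V) := {u | (∀ i, E (u i) (u (i + 1))) ∧ u n ∈ S ∧ u (n + p) ∈ S ∧
    ∀ i, n ≤ i → i < n + p → l (u i) = y i}
  have hW : pathFibre E l y ⊆ W := fun u hu =>
    ⟨hu.1, hn ▸ mem_image_of_mem _ hu, hm ▸ mem_image_of_mem _ hu, fun i _ _ => hu.2 i⟩
  have hz'W : z' ∈ W := ⟨hz'.1, hzz' ▸ (hW hz).2.1, hm' ▸ mem_image_of_mem _ hz',
    fun i h1 h2 => (hz'.2 i).trans (hyy' i h1 h2)⟩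
  have hnext (u : W) : ∃ v : W, v.1 n = u.1 (n + p) := by
    obtain ⟨v, hv, hvu⟩ := hn.symm ▸ u.2.2.2.1
    exact ⟨⟨v, hW hv⟩, hvu⟩
  have hprev (u : W) : ∃ v : W, v.1 (n + p) = u.1 n := by
    obtain ⟨v, hv, hvu⟩ := hm.symm ▸ u.2.2.1
    exact ⟨⟨v, hW hv⟩, hvu⟩
  choose next hnext using hnext
  choose prev hprev using hprev
  -- the chain of segments with `u` at time `0`, and the predecessors of `v` before
  let chain (u v : W) (t : ℤ) : W :=
    if 0 ≤ t then next^[t.toNat] u else prev^[(-t).toNat] v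
  have hchain (u v : W) (huv : u.1 n = v.1 n) (t : ℤ) :
      (chain u v t).1 (n + p) = (chain u v (t + 1)).1 n := by
    rcases lt_trichotomy t (-1) with ht | rfl | ht
    · have h1 : (-t).toNat = (-(t + 1)).toNat + 1 := by omega
      simp only [chain, if_neg (show ¬ 0 ≤ t by omega), if_neg (show ¬ 0 ≤ t + 1 by omega), h1,
        Function.iterate_succ_apply', hprev]
    · simp [chain, hprev, huv]
    · have h1 : (t + 1).toNat = t.toNat + 1 := by omega
      simp only [chain, if_pos (show 0 ≤ t by omega), if_pos (show 0 ≤ t + 1 by omega), h1,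
        Function.iterate_succ_apply', hnext]
  have hlabel (u v : W) (j : ℤ) := label_concat (l := l) (y := y) hp
    (w := fun t => (chain u v t).1) (fun t => (chain u v t).2.2.2.2) j
  have hpath (u v : W) (huv : u.1 n = v.1 n) := concat_isPath (E := E) hp
    (w := fun t => (chain u v t).1) (fun t => (chain u v t).2.1) (hchain u v huv)
  have heq := H p hp _ _ (hpath ⟨z, hW hz⟩ ⟨z, hW hz⟩ rfl) (hpath ⟨z', hz'W⟩ ⟨z, hW hz⟩ hzz'.symm)
    (fun j => by rw [hlabel, hlabel])
    (fun j => by rw [hlabel, hlabel, show j + p - n = j - n + p by ring, Int.add_emod_right])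
    n (fun j hj => by
      have : ¬ 0 ≤ (j - n) / p := not_le.2 (Int.ediv_neg_of_neg_of_pos (by omega) hp)
      simp only [concat, chain, if_neg this])
  have h1 : (i - n) / p = 0 := Int.ediv_eq_zero_of_lt (by omega) (by omega)
  have h2 : (i - n) % p = i - n := Int.emod_eq_of_lt (by omega) (by omega)
  have := congrFun heq i
  simpa [concat, chain, h1, h2] using this

/-- The sequence `y` is the label sequence of a path, and every finite part of every label sequence
of a path occurs in its left and right tails. -/
def IsPathTransitive (E : V → V → Prop) (l : V → B) (y : ℤ → B) : Prop :=
  (pathFibre E l y).Nonempty ∧ ∀ y₀, (pathFibre E l y₀).Nonempty → ∀ (N : ℕ) (M : ℤ),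
    (∃ n, M ≤ n ∧ AgreesAt y₀ N y n) ∧ ∃ n, n ≤ M ∧ AgreesAt y₀ N y n

/-- Let `c` be a code on the vertices. The paths over `y`, between two magic windows far apart,
are copied by paths over each transitive `y'`, at a place where `y'` contains the relevant part of
`y`. -/
theorem encard_image_pathFibre_le [Finite V] {E : V → V → Prop} {l : V → B} (c : V → A)
    (H : ∀ p > 0, ∀ z z' : ℤ → V, (∀ i, E (z i) (z (i + 1))) → (∀ i, E (z' i) (z' (i + 1))) →
      (∀ i, l (z i) = l (z' i)) → (∀ i, l (z (i + p)) = l (z i)) →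
      ∀ n, (∀ i < n, z i = z' i) → z = z')
    {y y' : ℤ → B} (hy : IsPathTransitive E l y) (hy' : IsPathTransitive E l y')
    (hfin : ((c ∘ ·) '' pathFibre E l y).Finite) :
    ((c ∘ ·) '' pathFibre E l y).encard ≤ ((c ∘ ·) '' pathFibre E l y').encard := by
  obtain ⟨z₀, hz₀⟩ := hy.1
  obtain ⟨y₀, N, S, hy₀, hS⟩ := exists_magic_window (l := l) hz₀.1
  set D := (c ∘ ·) '' pathFibre E l y with hD
  obtain ⟨K, hK⟩ : ∃ K : ℕ, ∀ x ∈ D, ∀ x' ∈ D, x ≠ x' → ∃ i, |i| ≤ (K : ℤ) ∧ x i ≠ x' i := by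
    have : ∀ᶠ K : ℕ in atTop, ∀ x ∈ D, ∀ x' ∈ D, x ≠ x' → ∃ i, |i| ≤ (K : ℤ) ∧ x i ≠ x' i := by
      refine (eventually_all_finite hfin).2 fun x _ => (eventually_all_finite hfin).2 fun x' _ => ?_
      by_cases hxx' : x = x'
      · simp [hxx']
      · obtain ⟨i, hi⟩ := Function.ne_iff.1 hxx'
        filter_upwards [eventually_ge_atTop i.natAbs] with K hK _
        exact ⟨i, by rw [Int.abs_eq_natAbs]; exact_mod_cast hK, hi⟩
    exact this.exists
  -- magic windows of `y` far enough apart to separate the points of `D` between them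
  obtain ⟨n, hnK, hn⟩ := (hy.2 y₀ hy₀ N (-K)).2
  obtain ⟨m, hmK, hm⟩ := (hy.2 y₀ hy₀ N (K + 1)).1
  obtain ⟨k, -, hk⟩ := (hy'.2 y hy.1 (n.natAbs + m.natAbs + N) 0).1
  -- `u` is `y'` shifted so as to agree with `y` on the windows around `n` and `m`
  let u : ℤ → B := fun i => y' (k + i)
  have hu : ∀ i, n - N ≤ i → i ≤ m + N → u i = y i := fun i h1 h2 =>
    hk i (by
      have := neg_abs_le n
      have := le_abs_self m
      have := abs_nonneg n
      have := abs_nonneg m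
      rw [abs_le]; push_cast; constructor <;> omega)
  have hune : (pathFibre E l u).Nonempty :=
    let ⟨_, hz⟩ := hy'.1
    ⟨_, shift_mem_pathFibre hz k⟩
  have hun : AgreesAt y₀ N u n := fun i hi => by
    rw [abs_le] at hi
    rw [← hn i (abs_le.2 hi), hu _ (by omega) (by omega)]
  have hum : AgreesAt y₀ N u m := fun i hi => by
    rw [abs_le] at hi
    rw [← hm i (abs_le.2 hi), hu _ (by omega) (by omega)]
  have hcopy : ∀ x ∈ D, ∃ x' ∈ (c ∘ ·) '' pathFibre E l y', ∀ i, n ≤ i → i < m →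
      x' (k + i) = x i := by
    rintro _ ⟨z, hz, rfl⟩
    have h1 : z n ∈ (fun z => z n) '' pathFibre E l u := by
      rw [hS u n hune hun, ← hS y n hy.1 hn]
      exact mem_image_of_mem _ hz
    obtain ⟨z', hz', hzz'⟩ := h1
    have h2 := eq_of_eq_left H (show n < m by omega) (fun i h1 h2 => hu i (by omega) (by omega))
      (hS y n hy.1 hn) (hS y m hy.1 hm) (hS u m hune hum) hz hz' hzz'.symm
    have h3 := shift_mem_pathFibre hz' (-k)
    simp only [u, add_neg_cancel_left] at h3
    refine ⟨_, mem_image_of_mem _ h3, fun i hi hi' => ?_⟩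
    simp [h2 i hi hi']
  choose! g hg hgx using hcopy
  refine encard_le_encard_of_injOn hg fun x hx x' hx' hxx' => ?_
  by_contra hne
  obtain ⟨i, hi, hxi⟩ := hK x hx x' hx' hne
  rw [abs_le] at hi
  exact hxi (by rw [← hgx x hx i (by omega) (by omega), ← hgx x' hx' i (by omega) (by omega), hxx'])

end Path

section Cover

/-! ### The deterministic cover of a sofic shift -/

variable {A : Type*} {n : ℕ}

/-- The vertices reached from `q` by an edge with label `a`. -/
def successors (G : Fin n → A → Fin n → Prop) (q : Set (Fin n)) (a : A) : Set (Fin n) :=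
  {t | ∃ s ∈ q, G s a t}

/-- The subset construction for the labelled graph `G`, combined with the passage to words of length
`2 * r + 1`. A vertex is a nonempty set of vertices of `G` with a word to be read from there; an
edge reads the first letter of the word. -/
def coverGraph (G : Fin n → A → Fin n → Prop) (r : ℕ)
    (v w : Set (Fin n) × (Fin (2 * r + 1) → A)) : Prop :=
  v.1.Nonempty ∧ w.1 = successors G v.1 (v.2 0) ∧ ∀ k : Fin (2 * r), v.2 k.succ = w.2 k.castSucc

/-- The letter in the middle of the word of a vertex of the cover. -/
def middle {r : ℕ} (v : Set (Fin n) × (Fin (2 * r + 1) → A)) : A :=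
  v.2 ⟨r, by omega⟩

variable {G : Fin n → A → Fin n → Prop} {r : ℕ}
  {z z' : ℤ → Set (Fin n) × (Fin (2 * r + 1) → A)}

theorem coverGraph_snd_eq (hz : ∀ i, coverGraph G r (z i) (z (i + 1))) (k : Fin (2 * r + 1))
    (i : ℤ) : (z i).2 k = (z (i + (k : ℕ))).2 0 := by
  induction k using Fin.induction generalizing i with
  | zero => simp
  | succ k ih =>
    rw [(hz i).2.2 k, ih (i + 1)]
    simp [add_assoc, add_comm (1 : ℤ)]

theorem middle_eq (hz : ∀ i, coverGraph G r (z i) (z (i + 1))) (i : ℤ) :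
    middle (z i) = (z (i + r)).2 0 :=
  coverGraph_snd_eq hz _ i

theorem coverGraph_snd_eq_middle (hz : ∀ i, coverGraph G r (z i) (z (i + 1)))
    (k : Fin (2 * r + 1)) (i : ℤ) : (z i).2 k = middle (z (i + (k : ℕ) - r)) := by
  rw [middle_eq hz, coverGraph_snd_eq hz, sub_add_cancel]

/-- The cover is deterministic: a path is determined by its labels and its past. -/
theorem coverGraph_deterministic (hz : ∀ i, coverGraph G r (z i) (z (i + 1)))
    (hz' : ∀ i, coverGraph G r (z' i) (z' (i + 1))) (hmid : ∀ i, middle (z i) = middle (z' i))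
    {m : ℤ} (hm : ∀ i < m, z i = z' i) : z = z' := by
  have h (k : ℕ) : z (m - 1 + k) = z' (m - 1 + k) := by
    induction k with
    | zero => exact hm _ (by omega)
    | succ k ih =>
      push_cast
      rw [← add_assoc]
      refine Prod.ext ?_ ?_
      · rw [(hz _).2.1, (hz' _).2.1, ih]
      · ext j
        rw [coverGraph_snd_eq_middle hz, coverGraph_snd_eq_middle hz', hmid]
  ext1 i
  by_cases hi : i < m
  · exact hm i hi
  · have := h (i - (m - 1)).toNat
    rwa [show m - 1 + ((i - (m - 1)).toNat : ℤ) = i by omega] at this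

/-- A bi-infinite path in the cover reads the label sequence of a path in `G`: finite parts of such
a path are found by going backwards from a vertex of the last set. -/
theorem exists_path_of_coverGraph (hz : ∀ i, coverGraph G r (z i) (z (i + 1))) :
    ∃ v : ℤ → Fin n, ∀ i, G (v i) (middle (z i)) (v (i + 1)) := by
  refine exists_int_sequence_of_forall_window (fun i s t => G s (middle (z i)) t) fun N => ?_
  have hpred (i : ℤ) (t : Fin n) : ∃ s, t ∈ (z (i + 1 + r)).1 →
      s ∈ (z (i + r)).1 ∧ G s (middle (z i)) t := by
    by_cases ht : t ∈ (z (i + 1 + r)).1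
    · have h1 := ht
      rw [add_right_comm, (hz _).2.1, ← middle_eq hz] at h1
      exact h1.imp fun s hs _ => hs
    · exact ⟨t, fun h => absurd h ht⟩
  choose pred hpred using hpred
  obtain ⟨t₀, ht₀⟩ := (hz (N + 1 + r)).1
  let u : ℕ → Fin n := fun k => Nat.rec t₀ (fun k t => pred (N - k) t) k
  have hu (k : ℕ) : u k ∈ (z (N - k + 1 + r)).1 := by
    induction k with
    | zero => simpa [u] using ht₀
    | succ k ih =>
      have := (hpred (N - k) (u k) ih).1
      rwa [show (N : ℤ) - (k + 1 : ℕ) + 1 + r = N - k + r by push_cast; ring]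
  refine ⟨fun i => u (N + 1 - i).toNat, fun i hi => ?_⟩
  rw [abs_le] at hi
  obtain ⟨k, hk⟩ : ∃ k : ℕ, (N : ℤ) - k = i := ⟨(N - i).toNat, by omega⟩
  have h1 : ((N : ℤ) + 1 - i).toNat = k + 1 := by omega
  have h2 : ((N : ℤ) + 1 - (i + 1)).toNat = k := by omega
  have := (hpred (N - k) (u k) (hu k)).2
  simp only [h1, h2]
  rw [← hk]
  exact this

/-- Every label sequence of a path in `G` is read by a path in the cover. -/
theorem exists_coverGraph_path {x : ℤ → A} {v : ℤ → Fin n}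
    (hv : ∀ i, G (v i) (x i) (v (i + 1))) (r : ℕ) :
    ∃ z : ℤ → Set (Fin n) × (Fin (2 * r + 1) → A),
      (∀ i, coverGraph G r (z i) (z (i + 1))) ∧ ∀ i, middle (z i) = x i := by
  -- the vertices in which a path with labels `x` up to time `i` can end
  let q (i : ℤ) : Set (Fin n) :=
    {t | ∃ v : ℤ → Fin n, (∀ j < i, G (v j) (x j) (v (j + 1))) ∧ v i = t}
  refine ⟨fun i => (q (i - r), fun k => x (i + (k : ℕ) - r)), fun i => ⟨?_, ?_, fun k => ?_⟩,
    fun i => by simp [middle]⟩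
  · exact ⟨v _, v, fun j _ => hv j, rfl⟩
  · simp only [add_sub_right_comm, Fin.val_zero, Nat.cast_zero, add_zero]
    ext t
    constructor
    · rintro ⟨v, hv, rfl⟩
      exact ⟨_, ⟨v, fun j hj => hv j (by omega), rfl⟩, hv _ (by omega)⟩
    · rintro ⟨_, ⟨v, hv, rfl⟩, ht⟩
      refine ⟨Function.update v (i - r + 1) t, fun j hj => ?_, by simp⟩
      rw [Function.update_of_ne (by omega)]
      rcases (show j ≤ i - r by omega).lt_or_eq with h | rfl
      · rw [Function.update_of_ne (by omega)]
        exact hv j h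
      · simpa using ht
  · simp [add_assoc, add_comm (1 : ℤ)]

end Cover

section Code

/-! ### Factor codes -/

variable {A B : Type*} [TopologicalSpace A] [TopologicalSpace B]
  {X : Subshift A ℤ} {Y : Subshift B ℤ} {π : X.carrier → Y.carrier}

/-- The shift by `i`. -/
def shiftBy (X : Subshift A ℤ) (i : ℤ) (x : X.carrier) : X.carrier :=
  ⟨fun j => x.1 (i + j), X.mapsTo i x.2⟩

theorem shiftBy_add (i j : ℤ) (x : X.carrier) :
    shiftBy X (i + j) x = shiftBy X j (shiftBy X i x) := by
  ext k
  simp [shiftBy, add_assoc]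

@[simp]
theorem shiftBy_zero (x : X.carrier) : shiftBy X 0 x = x := by
  ext k
  simp [shiftBy]

theorem shiftBy_one : shiftBy X 1 = shiftMap X := rfl

theorem occursAt_shiftBy {w : List A} {x : X.carrier} {i j : ℤ} :
    OccursAt w (shiftBy X i x).1 j ↔ OccursAt w x.1 (i + j) := by
  simp [OccursAt, shiftBy, add_assoc]

theorem iterate_shiftMap (k : ℕ) (x : X.carrier) : (shiftMap X)^[k] x = shiftBy X k x := by
  induction k with
  | zero => simp
  | succ k ih => rw [Function.iterate_succ_apply', ih, ← shiftBy_one, ← shiftBy_add]; norm_cast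

theorem map_shiftBy (hπ : Function.Semiconj π (shiftMap X) (shiftMap Y)) (i : ℤ) (x : X.carrier) :
    π (shiftBy X i x) = shiftBy Y i (π x) := by
  have hnat (k : ℕ) (x : X.carrier) : π (shiftBy X k x) = shiftBy Y k (π x) := by
    rw [← iterate_shiftMap, ← iterate_shiftMap]
    exact hπ.iterate_right k x
  obtain ⟨k, rfl | rfl⟩ := i.eq_nat_or_neg
  · exact hnat k x
  · have := hnat k (shiftBy X (-k) x)
    rw [← shiftBy_add, neg_add_cancel, shiftBy_zero] at this
    rw [this, ← shiftBy_add, add_neg_cancel, shiftBy_zero]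

instance compactSpace_carrier [Finite A] (X : Subshift A ℤ) : CompactSpace X.carrier :=
  isCompact_iff_compactSpace.1 X.isClosed.isCompact

theorem continuous_coord (i : ℤ) : Continuous fun x : X.carrier => x.1 i :=
  (continuous_apply i).comp continuous_subtype_val

theorem continuous_shiftBy (i : ℤ) : Continuous (shiftBy X i) :=
  Continuous.subtype_mk (continuous_pi fun _ => continuous_coord _) _

/-- By compactness, the letter at `0` of the image under a continuous map depends on a
finite window. -/
theorem exists_radius [Finite A] [DiscreteTopology A] [DiscreteTopology B] (hπ : Continuous π) :
    ∃ r : ℕ, ∀ x x' : X.carrier, (∀ i, |i| ≤ (r : ℤ) → x.1 i = x'.1 i) →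
      (π x).1 0 = (π x').1 0 := by
  by_contra! hcon
  let Q : ℕ → Set (X.carrier × X.carrier) := fun N =>
    {w | (∀ i, |i| ≤ (N : ℤ) → w.1.1 i = w.2.1 i) ∧ (π w.1).1 0 ≠ (π w.2).1 0}
  have hcl (N : ℕ) : IsClosed (Q N) := by
    refine IsClosed.inter ?_ ?_
    · have : {w : X.carrier × X.carrier | ∀ i, |i| ≤ (N : ℤ) → w.1.1 i = w.2.1 i} =
          ⋂ i, ⋂ (_ : |i| ≤ (N : ℤ)), {w | w.1.1 i = w.2.1 i} := by ext; simp
      change IsClosed {w : X.carrier × X.carrier | ∀ i, |i| ≤ (N : ℤ) → w.1.1 i = w.2.1 i}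
      rw [this]
      exact isClosed_iInter fun i => isClosed_iInter fun _ => isClosed_eq
        ((continuous_coord i).comp continuous_fst) ((continuous_coord i).comp continuous_snd)
    · exact (isClosed_discrete {b : B × B | b.1 ≠ b.2}).preimage
        (((continuous_coord 0).comp (hπ.comp continuous_fst)).prodMk
          ((continuous_coord 0).comp (hπ.comp continuous_snd)))
  obtain ⟨w, hw⟩ := IsCompact.nonempty_iInter_of_sequence_nonempty_isCompact_isClosed Q
    (fun N w hw => ⟨fun i hi => hw.1 i (hi.trans (by push_cast; omega)), hw.2⟩)
    (fun N => let ⟨x, x', h⟩ := hcon N; ⟨(x, x'), h⟩) (hcl 0).isCompact hcl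
  rw [mem_iInter] at hw
  refine (hw 0).2 (congrArg (fun x => (π x).1 0) ?_)
  ext i
  exact (hw i.natAbs).1 i (by simp)

/-- A doubly transitive point contains each finite part of each point of the subshift, infinitely
often in both directions. -/
theorem IsDoublyTransitive.agreesAt {y : Y.carrier} (hy : IsDoublyTransitive y) (y₀ : Y.carrier)
    (N : ℕ) (M : ℤ) :
    (∃ n, M ≤ n ∧ AgreesAt y₀.1 N y.1 n) ∧ ∃ n, n ≤ M ∧ AgreesAt y₀.1 N y.1 n := by
  let w : List B := List.ofFn fun k : Fin (2 * N + 1) => y₀.1 ((k : ℕ) - N)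
  have hw : w ∈ language Y := by
    refine ⟨y₀.1, y₀.2, -N, fun k => ?_⟩
    simp only [w, List.get_eq_getElem, List.getElem_ofFn, neg_add_eq_sub]
  have key (i : ℤ) (hi : OccursAt w y.1 i) : AgreesAt y₀.1 N y.1 (i + N) := by
    intro j hj
    rw [abs_le] at hj
    have := hi ⟨(j + N).toNat, by simp [w]; omega⟩
    have h1 : ((j + N).toNat : ℤ) = j + N := by omega
    simp only [h1, w, List.get_eq_getElem, List.getElem_ofFn] at this
    rw [add_assoc, add_comm (N : ℤ), this, add_sub_cancel_right]
  obtain ⟨⟨i, hi, hiw⟩, ⟨j, hj, hjw⟩⟩ := hy w hw (M - N)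
  exact ⟨⟨i + N, by omega, key i hiw⟩, ⟨j + N, by omega, key j hjw⟩⟩

/-- The points over a periodic point form a finite set invariant under a power of the shift, so any
two of them have a common period, and they are equal if they have the same past. -/
theorem eq_of_agree_left_of_periodic_image (hπ : Function.Semiconj π (shiftMap X) (shiftMap Y))
    (hfin : IsFiniteToOne π) {x x' : X.carrier} (hxx' : π x = π x') {p : ℤ} (hp : 0 < p)
    (hper : shiftBy Y p (π x) = π x) {m : ℤ} (hm : ∀ i < m, x.1 i = x'.1 i) : x = x' := by
  have hperk (k : ℕ) : shiftBy Y (p * k) (π x) = π x := by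
    induction k with
    | zero => simp
    | succ k ih => rw [Nat.cast_succ, mul_add, mul_one, shiftBy_add, ih, hper]
  have := (hfin (π x)).to_subtype
  let f : ℕ → (π ⁻¹' {π x}) × (π ⁻¹' {π x}) := fun k =>
    (⟨shiftBy X (p * k) x, by simp [map_shiftBy hπ, hperk]⟩,
      ⟨shiftBy X (p * k) x', by simp [map_shiftBy hπ, ← hxx', hperk]⟩)
  obtain ⟨k, l, hkl, hfkl⟩ : ∃ k l, k < l ∧ f k = f l := by
    obtain ⟨k, l, hkl, hfkl⟩ := Finite.exists_ne_map_eq_of_infinite f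
    rcases hkl.lt_or_gt with h | h
    exacts [⟨k, l, h, hfkl⟩, ⟨l, k, h, hfkl.symm⟩]
  -- both points have the period `q`
  set q : ℤ := p * l - p * k with hq
  have hq0 : 0 < q := by
    rw [hq, ← mul_sub]
    exact mul_pos hp (by omega)
  simp only [f, Prod.mk.injEq, Subtype.mk.injEq, shiftBy] at hfkl
  have hx (i : ℤ) : x.1 (i - q) = x.1 i := by
    have := congrFun (congrArg Subtype.val hfkl.1) (i - p * l)
    simp only at this
    rwa [show p * k + (i - p * l) = i - q by rw [hq]; ring, add_sub_cancel] at this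
  have hx' (i : ℤ) : x'.1 (i - q) = x'.1 i := by
    have := congrFun (congrArg Subtype.val hfkl.2) (i - p * l)
    simp only at this
    rwa [show p * k + (i - p * l) = i - q by rw [hq]; ring, add_sub_cancel] at this
  have hind (N : ℕ) : ∀ i < m + N, x.1 i = x'.1 i := by
    induction N with
    | zero => simpa using hm
    | succ N ih =>
      intro i hi
      rw [← hx, ← hx']
      exact ih _ (by push_cast at hi; omega)
  ext i
  exact hind (i - m + 1).toNat i (by omega)

/-- The code factors a one-block code on the paths of the deterministic cover of `X`, to which
`encard_image_pathFibre_le` applies: over a periodic point, paths with the same past have the same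
image in `X`, because `π` is finite-to-one, and are then equal by determinism. -/
theorem encard_fibre_le [Finite A] [DiscreteTopology A] [DiscreteTopology B]
    (hsofic : IsSofic X) (hπ : IsFactorCode π) (hfin : IsFiniteToOne π) {y y' : Y.carrier}
    (hy : IsDoublyTransitive y) (hy' : IsDoublyTransitive y') :
    (π ⁻¹' {y}).encard ≤ (π ⁻¹' {y'}).encard := by
  obtain ⟨n, G, hG⟩ := hsofic
  obtain ⟨r, hr⟩ := exists_radius hπ.continuous
  let V := Set (Fin n) × (Fin (2 * r + 1) → A)
  have hmem (z : ℤ → V) (hz : ∀ i, coverGraph G r (z i) (z (i + 1))) :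
      (fun i => middle (z i)) ∈ X.carrier := by
    rw [hG]
    exact exists_path_of_coverGraph hz
  have hlift (x : X.carrier) : ∃ z : ℤ → V, (∀ i, coverGraph G r (z i) (z (i + 1))) ∧
      ∀ i, middle (z i) = x.1 i := by
    obtain ⟨v, hv⟩ : x.1 ∈ {x | ∃ v : ℤ → Fin n, ∀ i, G (v i) (x i) (v (i + 1))} := hG ▸ x.2
    exact exists_coverGraph_path hv r
  have hblock (v : V) : ∃ b, ∀ x : X.carrier, (∀ k : Fin (2 * r + 1), x.1 ((k : ℕ) - r) = v.2 k) →
      (π x).1 0 = b := by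
    by_cases hv : ∃ x : X.carrier, ∀ k : Fin (2 * r + 1), x.1 ((k : ℕ) - r) = v.2 k
    · obtain ⟨x, hx⟩ := hv
      refine ⟨(π x).1 0, fun x' hx' => hr _ _ fun i hi => ?_⟩
      rw [abs_le] at hi
      have h1 := (hx' ⟨(i + r).toNat, by omega⟩).trans (hx ⟨(i + r).toNat, by omega⟩).symm
      simp only [show ((i + r).toNat : ℤ) - r = i by omega] at h1
      exact h1
    · exact ⟨y.1 0, fun x hx => absurd ⟨x, hx⟩ hv⟩
  choose l hl using hblock
  have hlabel (z : ℤ → V) (hz : ∀ i, coverGraph G r (z i) (z (i + 1))) (i : ℤ) :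
      l (z i) = (π ⟨_, hmem z hz⟩).1 i := by
    have h1 := hl (z i) (shiftBy X i ⟨_, hmem z hz⟩) fun k => by
      rw [coverGraph_snd_eq_middle hz, shiftBy, add_sub_assoc]
    rw [← h1, map_shiftBy hπ.semiconj]
    simp [shiftBy]
  have himage (y : Y.carrier) :
      (middle ∘ ·) '' pathFibre (coverGraph G r) l y.1 = Subtype.val '' (π ⁻¹' {y}) := by
    ext x
    constructor
    · rintro ⟨z, hz, rfl⟩
      refine ⟨⟨_, hmem z hz.1⟩, ?_, rfl⟩
      ext i
      rw [← hz.2, hlabel z hz.1]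
    · rintro ⟨x, hx, rfl⟩
      obtain ⟨z, hz, hzx⟩ := hlift x
      have h1 : (⟨_, hmem z hz⟩ : X.carrier) = x := Subtype.ext (funext hzx)
      refine ⟨z, ⟨hz, fun i => ?_⟩, funext hzx⟩
      rw [hlabel z hz, h1, hx]
  have htrans {y : Y.carrier} (hy : IsDoublyTransitive y) :
      IsPathTransitive (coverGraph G r) l y.1 := by
    refine ⟨?_, fun y₀ ⟨z, hz⟩ N M => ?_⟩
    · rw [← image_nonempty (f := (middle ∘ ·)), himage, image_nonempty]
      exact hπ.surjective y
    · have h1 : (π ⟨_, hmem z hz.1⟩).1 = y₀ := funext fun i => by rw [← hlabel z hz.1, hz.2]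
      rw [← h1]
      exact hy.agreesAt _ N M
  have key := encard_image_pathFibre_le (E := coverGraph G r) (l := l) middle ?_
    (htrans hy) (htrans hy') (by rw [himage]; exact (hfin y).image _)
  · rwa [himage, himage, Subtype.val_injective.encard_image,
      Subtype.val_injective.encard_image] at key
  · intro p hp z z' hz hz' hzz' hper m hm
    have h1 : π ⟨_, hmem z hz⟩ = π ⟨_, hmem z' hz'⟩ := Subtype.ext <| funext fun i => by
      rw [← hlabel z hz, ← hlabel z' hz', hzz']
    refine coverGraph_deterministic hz hz' (fun i => ?_) hm
    have h2 := eq_of_agree_left_of_periodic_image hπ.semiconj hfin h1 hp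
      (Subtype.ext <| funext fun i => by
        simp only [shiftBy]
        rw [← hlabel z hz, ← hlabel z hz, add_comm, hper]) (m := m)
      (fun i hi => congrArg middle (hm i hi))
    exact congrFun (congrArg Subtype.val h2) i

theorem isDegree_degree [Finite A] [DiscreteTopology A] [DiscreteTopology B]
    (hsofic : IsSofic X) (hπ : IsFactorCode π)
    (hfin : IsFiniteToOne π) (hex : ∃ y : Y.carrier, IsDoublyTransitive y) :
    IsDegree π (degree π) := by
  have h : ∃ d, IsDegree π d := by
    obtain ⟨y₀, hy₀⟩ := hex
    refine ⟨(π ⁻¹' {y₀}).ncard, ⟨y₀, hy₀⟩, fun y hy => ?_⟩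
    rw [(hfin y₀).cast_ncard_eq]
    exact le_antisymm (encard_fibre_le hsofic hπ hfin hy hy₀)
      (encard_fibre_le hsofic hπ hfin hy₀ hy)
  rw [degree, dif_pos h]
  exact h.choose_spec

end Code

section Shift

/-! ### Measures on subshifts -/

theorem ae_frequently_mem_of_ergodic {Y : Type*} [MeasurableSpace Y] {T : Y → Y} {ν : Measure Y}
    [IsFiniteMeasure ν] (hT : Ergodic T ν) {s : Set Y} (hs : MeasurableSet s) (h0 : ν s ≠ 0) :
    ∀ᵐ y ∂ν, ∃ᶠ k in atTop, T^[k] y ∈ s := by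
  have hD : MeasurableSet (⋃ k : ℕ, T^[k] ⁻¹' s) :=
    MeasurableSet.iUnion fun k => (hT.measurable.iterate k) hs
  have hTD : T ⁻¹' (⋃ k : ℕ, T^[k] ⁻¹' s) ⊆ ⋃ k : ℕ, T^[k] ⁻¹' s := by
    intro y hy
    obtain ⟨k, hk⟩ := mem_iUnion.1 hy
    exact mem_iUnion.2 ⟨k + 1, hk⟩
  rcases hT.ae_empty_or_univ_of_preimage_ae_le hD.nullMeasurableSet
    (Eventually.of_forall hTD) with h | h
  · refine absurd (measure_mono_null ?_ (ae_eq_empty.1 h)) h0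
    exact subset_iUnion (fun k : ℕ => T^[k] ⁻¹' s) 0
  · filter_upwards [eventuallyEq_univ.1 h,
      hT.toMeasurePreserving.conservative.ae_forall_image_mem_imp_frequently_image_mem
        hs.nullMeasurableSet] with y hy hrec
    obtain ⟨k, hk⟩ := mem_iUnion.1 hy
    exact hrec k hk

variable {A : Type*} [Finite A] [TopologicalSpace A] [DiscreteTopology A] [MeasurableSpace A]
  [BorelSpace A] {X : Subshift A ℤ}

/-- The shift map as a measurable automorphism. -/
def shiftEquiv (X : Subshift A ℤ) : X.carrier ≃ᵐ X.carrier where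
  toFun := shiftMap X
  invFun := shiftBy X (-1)
  left_inv x := by rw [← shiftBy_one, ← shiftBy_add, add_neg_cancel, shiftBy_zero]
  right_inv x := by rw [← shiftBy_one, ← shiftBy_add, neg_add_cancel, shiftBy_zero]
  measurable_toFun := (continuous_shiftBy 1).measurable
  measurable_invFun := (continuous_shiftBy (-1)).measurable

theorem iterate_shiftEquiv_symm (k : ℕ) (x : X.carrier) :
    (shiftEquiv X).symm^[k] x = shiftBy X (-k) x := by
  induction k with
  | zero => simp
  | succ k ih =>
    rw [Function.iterate_succ_apply', ih]
    change shiftBy X (-1) _ = _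
    rw [← shiftBy_add]
    congr 1
    push_cast
    ring

/-- Almost every point is doubly transitive: by recurrence and ergodicity, almost every orbit visits
every cylinder infinitely often in both directions of time. -/
theorem ae_isDoublyTransitive (μ : Measure X.carrier) [IsProbabilityMeasure μ] [μ.IsOpenPosMeasure]
    (hμ : Ergodic (shiftMap X) μ) : ∀ᵐ y ∂μ, IsDoublyTransitive y := by
  have hμ' : Ergodic (shiftEquiv X) μ := hμ
  have key (w : List A) : ∀ᵐ y ∂μ, w ∈ language X → ∀ N : ℤ,
      (∃ i : ℤ, N ≤ i ∧ OccursAt w y.1 i) ∧ ∃ i : ℤ, i ≤ N ∧ OccursAt w y.1 i := by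
    by_cases hw : w ∈ language X
    · obtain ⟨x, hx, i, hi⟩ := hw
      set O : Set X.carrier := {y | OccursAt w y.1 0} with hO
      have hOo : IsOpen O := by
        have : O = ⋂ k : Fin w.length, (fun y : X.carrier => y.1 (0 + (k : ℕ))) ⁻¹' {w.get k} := by
          ext; simp [hO, OccursAt]
        rw [this]
        exact isOpen_iInter_of_finite fun k => (isOpen_discrete _).preimage (continuous_coord _)
      have h0 : μ O ≠ 0 :=
        (hOo.measure_pos μ ⟨shiftBy X i ⟨x, hx⟩, occursAt_shiftBy.2 (by simpa using hi)⟩).ne'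
      filter_upwards [ae_frequently_mem_of_ergodic hμ hOo.measurableSet h0,
        ae_frequently_mem_of_ergodic hμ'.symm hOo.measurableSet h0] with y h1 h2 _ N
      rw [frequently_atTop] at h1 h2
      obtain ⟨k, hk, hky⟩ := h1 N.toNat
      obtain ⟨l, hl, hly⟩ := h2 (-N).toNat
      rw [iterate_shiftMap, hO, mem_ofPred_eq, occursAt_shiftBy, add_zero] at hky
      rw [iterate_shiftEquiv_symm, hO, mem_ofPred_eq, occursAt_shiftBy, add_zero] at hly
      exact ⟨⟨k, by omega, hky⟩, ⟨-l, by omega, hly⟩⟩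
    · exact Eventually.of_forall fun y h => absurd h hw
  filter_upwards [ae_all_iff.2 key] with y hy w hw
  exact hy w hw

end Shift

section Joining

/-! ### Degree joinings -/

variable {A B : Type*} [TopologicalSpace A] [MeasurableSpace A] [TopologicalSpace B]
  [MeasurableSpace B] {X : Subshift A ℤ} {Y : Subshift B ℤ} {π : X.carrier → Y.carrier}

theorem IsRelativeJoining.map_eq (hπ : Measurable π) {ν : Measure Y.carrier} {n : ℕ}
    {ρ : Measure (Fin n → X.carrier)} (hρ : IsRelativeJoining π ν n ρ) (i : Fin n) :
    ρ.map (fun x => π (x i)) = ν := by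
  obtain ⟨j, hj⟩ := hρ.image_eq
  rw [margin, Measure.map_map hπ (measurable_pi_apply j)] at hj
  rw [← hj]
  exact Measure.map_congr (hρ.ae_image_eq.mono fun x hx => hx i j)

theorem IsDegreeJoining.isProbabilityMeasure_margin {ν : Measure Y.carrier}
    {ρ : Measure (Fin (degree π) → X.carrier)} (hρ : IsDegreeJoining π ν ρ) (i : Fin (degree π)) :
    IsProbabilityMeasure (margin ρ i) := by
  have := hρ.isRelativeJoining.isProbabilityMeasure
  exact Measure.isProbabilityMeasure_map (measurable_pi_apply i).aemeasurable

variable [Finite A] [DiscreteTopology A] [BorelSpace A]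

theorem IsDegreeJoining.ergodic_margin {ν : Measure Y.carrier}
    {ρ : Measure (Fin (degree π) → X.carrier)} (hρ : IsDegreeJoining π ν ρ) (i : Fin (degree π)) :
    Ergodic (shiftMap X) (margin ρ i) :=
  ((measurable_pi_apply i).measurePreserving ρ).ergodic_of_ergodic_semiconj hρ.ergodic
    (shiftEquiv X).measurable fun _ => rfl

theorem IsDegreeJoining.margin_mem_ergodicLifts (hπ : Measurable π) {ν : Measure Y.carrier}
    {ρ : Measure (Fin (degree π) → X.carrier)} (hρ : IsDegreeJoining π ν ρ) (i : Fin (degree π)) :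
    margin ρ i ∈ ergodicLifts π ν := by
  refine ⟨hρ.isProbabilityMeasure_margin i, hρ.ergodic_margin i, ?_⟩
  rw [margin, Measure.map_map hπ (measurable_pi_apply i)]
  exact hρ.isRelativeJoining.map_eq hπ i

variable [Finite B] [DiscreteTopology B] [BorelSpace B]

/-- The number of points of a compact set in the fibre over `y` is the supremum over `N` of the
number of words on `[-N, N]` which these points carry. The points `y` at which a given word
contributes form the image of a compact set. -/
theorem measurable_fibreMeasure (hπ : Continuous π) (hfin : IsFiniteToOne π) :
    Measurable (fibreMeasure π) := by
  have := isFiniteMeasure_fibreMeasure hfin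
  have hclosed (K : Set X.carrier) (hK : IsClosed K) : Measurable fun y => fibreMeasure π y K := by
    let res (N : ℕ) (x : X.carrier) : Finset.Icc (-N : ℤ) N → A := fun i => x.1 i
    have hres (N : ℕ) : Continuous (res N) := continuous_pi fun i => continuous_coord _
    have hcount (y : Y.carrier) : fibreMeasure π y K =
        ⨆ N : ℕ, ((res N '' (K ∩ π ⁻¹' {y})).encard : ENNReal) := by
      rw [fibreMeasure_apply hfin y hK.measurableSet]
      have hF : (K ∩ π ⁻¹' {y}).Finite := (hfin y).inter_of_right _
      refine le_antisymm ?_ (iSup_le fun N => by exact_mod_cast encard_image_le _ _)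
      have hinj : ∀ᶠ N : ℕ in atTop, ∀ x ∈ K ∩ π ⁻¹' {y}, ∀ x' ∈ K ∩ π ⁻¹' {y},
          res N x = res N x' → x = x' := by
        refine (eventually_all_finite hF).2 fun x _ => (eventually_all_finite hF).2 fun x' _ => ?_
        by_cases hxx' : x = x'
        · simp [hxx']
        · obtain ⟨i, hi⟩ := Function.ne_iff.1 fun h => hxx' (Subtype.ext h)
          filter_upwards [eventually_ge_atTop i.natAbs] with N hN h
          exact absurd (congrFun h ⟨i, by rw [Finset.mem_Icc]; omega⟩) hi
      obtain ⟨N, hN⟩ := hinj.exists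
      refine le_iSup_of_le N ?_
      rw [InjOn.encard_image fun x hx x' hx' h => hN x hx x' hx' h]
    simp_rw [hcount]
    refine Measurable.iSup fun N => ?_
    classical
    let _ : Fintype (Finset.Icc (-N : ℤ) N → A) := Fintype.ofFinite _
    have hsum (y : Y.carrier) : ((res N '' (K ∩ π ⁻¹' {y})).encard : ENNReal) =
        ∑ u, (π '' (K ∩ res N ⁻¹' {u})).indicator 1 y := by
      have h1 (u : Finset.Icc (-N : ℤ) N → A) :
          y ∈ π '' (K ∩ res N ⁻¹' {u}) ↔ u ∈ res N '' (K ∩ π ⁻¹' {y}) := by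
        constructor
        · rintro ⟨x, ⟨hxK, rfl⟩, rfl⟩
          exact ⟨x, ⟨hxK, rfl⟩, rfl⟩
        · rintro ⟨x, ⟨hxK, rfl⟩, rfl⟩
          exact ⟨x, ⟨hxK, rfl⟩, rfl⟩
      simp only [indicator_apply, h1]
      generalize res N '' (K ∩ π ⁻¹' {y}) = W
      rw [encard_eq_coe_toFinset_card]
      simp
    simp_rw [hsum]
    refine Finset.measurable_fun_sum _ fun u _ => measurable_one.indicator ?_
    exact ((hK.inter ((isClosed_discrete {u}).preimage (hres N))).isCompact.image
      hπ).isClosed.measurableSet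
  exact Measurable.measure_of_isPiSystem
    (BorelSpace.measurable_eq.trans borel_eq_generateFrom_isClosed) isPiSystem_isClosed hclosed
    (hclosed univ isClosed_univ)

theorem IsDegreeJoining.sum_margin (hπ : Continuous π) (hfin : IsFiniteToOne π)
    {ν : Measure Y.carrier} (hd : ∀ᵐ y ∂ν, (π ⁻¹' {y}).ncard = degree π)
    {ρ : Measure (Fin (degree π) → X.carrier)} (hρ : IsDegreeJoining π ν ρ) :
    ∑ i, margin ρ i = ν.bind (fibreMeasure π) :=
  let ⟨i₀, _⟩ := hρ.isRelativeJoining.image_eq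
  sum_margins_eq_bind hfin (measurable_fibreMeasure hπ hfin) hπ.measurable hd hρ.isSeparating
    hρ.isRelativeJoining.ae_image_eq i₀ (hρ.isRelativeJoining.map_eq hπ.measurable i₀)

theorem exists_isDegreeJoining (hπ : IsFactorCode π) (hfin : IsFiniteToOne π)
    {ν : Measure Y.carrier} [IsProbabilityMeasure ν] (hν : Ergodic (shiftMap Y) ν)
    (hd : ∀ᵐ y ∂ν, (π ⁻¹' {y}).ncard = degree π) : ∃ ρ, IsDegreeJoining π ν ρ := by
  have hm := hπ.continuous.measurable
  obtain ⟨ρ, hprob, herg, hinj, him, hsame⟩ := exists_ergodic_separating hfin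
    (measurable_fibreMeasure hπ.continuous hfin) hm (shiftEquiv X) (shiftEquiv Y).injective
    hπ.semiconj hν hd
  obtain ⟨y, hy⟩ := hd.exists
  have hpos : 0 < degree π := by
    rw [← hy, ncard_pos (hfin y)]
    exact hπ.surjective y
  refine ⟨ρ, ⟨hprob, herg.toMeasurePreserving, hsame, ⟨0, hpos⟩, ?_⟩, hinj, herg⟩
  rw [margin, Measure.map_map hm (measurable_pi_apply (⟨0, hpos⟩ : Fin (degree π)))]
  exact him _

/-- An ergodic lift is absolutely continuous with respect to the sum of the margins, which are
ergodic, so it is one of them. -/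
theorem IsDegreeJoining.exists_margin_eq (hπ : Continuous π) (hfin : IsFiniteToOne π)
    {ν : Measure Y.carrier} (hd : ∀ᵐ y ∂ν, (π ⁻¹' {y}).ncard = degree π)
    {ρ : Measure (Fin (degree π) → X.carrier)} (hρ : IsDegreeJoining π ν ρ)
    {μ : Measure X.carrier} (hμ : μ ∈ ergodicLifts π ν) : ∃ i, margin ρ i = μ := by
  have := hμ.1
  have := hρ.isProbabilityMeasure_margin
  refine exists_eq_of_absolutelyContinuous_sum hρ.ergodic_margin hμ.2.1 ?_
  rw [hρ.sum_margin hπ hfin hd, ← hμ.2.2]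
  exact absolutelyContinuous_bind_fibreMeasure hfin (measurable_fibreMeasure hπ hfin)
    hπ.measurable μ

theorem IsDegreeJoining.multiplicity_eq (hπ : Continuous π) (hfin : IsFiniteToOne π)
    {ν : Measure Y.carrier} (hd : ∀ᵐ y ∂ν, (π ⁻¹' {y}).ncard = degree π)
    {ρ : Measure (Fin (degree π) → X.carrier)} (hρ : IsDegreeJoining π ν ρ)
    {μ : Measure X.carrier} (hμ : μ ∈ ergodicLifts π ν) :
    multiplicity π μ = marginCount ρ μ := by
  obtain ⟨hμp, hμe, rfl⟩ := hμ
  have h : ∃ ρ, IsDegreeJoining π (μ.map π) ρ := ⟨ρ, hρ⟩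
  rw [multiplicity, dif_pos h]
  have := h.choose_spec.isProbabilityMeasure_margin
  have := hρ.isProbabilityMeasure_margin
  refine card_eq_card_of_sum_eq h.choose_spec.ergodic_margin hρ.ergodic_margin hμe ?_
  rw [h.choose_spec.sum_margin hπ hfin hd, hρ.sum_margin hπ hfin hd]

end Joining
end FactorCode

/-- Besides the identity itself, the conclusion records that its terms are well defined: the degree
exists, degree joinings over `ν` exist, the multiplicity does not depend on the degree joining, and
`ν` has only finitely many ergodic lifts. -/
theorem mainTheorem1 {A B : Type*}
    [Finite A] [TopologicalSpace A] [DiscreteTopology A] [MeasurableSpace A] [BorelSpace A]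
    [Finite B] [TopologicalSpace B] [DiscreteTopology B] [MeasurableSpace B] [BorelSpace B]
    (X : Subshift A ℤ) (Y : Subshift B ℤ)
    (hirr : FactorCode.IsIrreducible X) (hsofic : FactorCode.IsSofic X)
    (π : X.carrier → Y.carrier)
    (hπ : FactorCode.IsFactorCode π) (hfin : FactorCode.IsFiniteToOne π)
    (ν : Measure Y.carrier) [IsProbabilityMeasure ν] [ν.IsOpenPosMeasure]
    (hν : Ergodic (FactorCode.shiftMap Y) ν) :
    FactorCode.IsDegree π (FactorCode.degree π) ∧
    (∃ ρ, FactorCode.IsDegreeJoining π ν ρ) ∧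
    (∀ ρ, FactorCode.IsDegreeJoining π ν ρ → ∀ μ ∈ FactorCode.ergodicLifts π ν,
      FactorCode.multiplicity π μ = FactorCode.marginCount ρ μ) ∧
    ∃ hlifts : (FactorCode.ergodicLifts π ν).Finite,
      FactorCode.degree π = ∑ μ ∈ hlifts.toFinset, FactorCode.multiplicity π μ := by
  classical
  have hae := FactorCode.ae_isDoublyTransitive ν hν
  have hdeg := FactorCode.isDegree_degree hsofic hπ hfin hae.exists
  have hd : ∀ᵐ y ∂ν, (π ⁻¹' {y}).ncard = FactorCode.degree π :=
    hae.mono fun y hy => by rw [Set.ncard, hdeg.2 y hy, ENat.toNat_natCast]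
  obtain ⟨ρ, hρ⟩ := FactorCode.exists_isDegreeJoining hπ hfin hν hd
  have hlifts : (FactorCode.ergodicLifts π ν).Finite :=
    (Set.finite_range (FactorCode.margin ρ)).subset fun μ hμ =>
      hρ.exists_margin_eq hπ.continuous hfin hd hμ
  refine ⟨hdeg, ⟨ρ, hρ⟩, fun ρ hρ μ hμ => hρ.multiplicity_eq hπ.continuous hfin hd hμ, hlifts, ?_⟩
  calc FactorCode.degree π = (Finset.univ : Finset (Fin (FactorCode.degree π))).card := by simp
    _ = ∑ μ ∈ hlifts.toFinset, (Finset.univ.filter fun i => FactorCode.margin ρ i = μ).card :=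
        Finset.card_eq_sum_card_fiberwise fun i _ =>
          hlifts.mem_toFinset.2 (hρ.margin_mem_ergodicLifts hπ.continuous.measurable i)
    _ = ∑ μ ∈ hlifts.toFinset, FactorCode.multiplicity π μ := by
        refine Finset.sum_congr rfl fun μ hμ => ?_
        rw [hρ.multiplicity_eq hπ.continuous hfin hd (hlifts.mem_toFinset.1 hμ),
          FactorCode.marginCount, Set.ncard_eq_toFinset_card']
        simp
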